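/- Let $a>0$ and let $q_{i,r}\ge 0$ ($i=0,1$; $r=0,1,2$) satisfy $\sum_{r=0}^{2}q_{i,r}=1$ for $i=0,1$. Consider the hexagonal lattice with vertex classes $$\mathscr V_i=\left\{\left(\tfrac32 aj+ia,\ \tfrac{\sqrt3}{2}aj+\sqrt3\,ak\right):\ j,k\in\mathbb Z\right\},\qquad i=0,1,$$ and let $\{(X_n,Y_n):n\ge 0\}$ be the random walk on $\mathscr V_0\cup\mathscr V_1$ with $\mathbb P[(X_0,Y_0)=(0,0)]=1$ and one-step transition probabilities $$\mathbb P\left[(X_{n+1},Y_{n+1})=\left(x+a\cos\left(\tfrac{2\pi r}{3}+i\pi\right),\,y+a\sin\left(\tfrac{2\pi r}{3}+i\pi\right)\right)\,\middle|\,(X_n,Y_n)=(x,y)\right]=q_{i,r}$$ for $(x,y)\in\mathscr V_i$ with $\mathbb P[(X_n,Y_n)=(x,y)]>0$, $i=0,1$, $r=0,1,2$, $n\ge0$ (no further property of the joint law is needed). For $(\lambda_1,\lambda_2)\in\mathbb R^2$ put $$g_i(\lambda_1,\lambda_2)=q_{i,0}+q_{i,1}e^{(-1)^i\sqrt3a\left(-\frac{\sqrt3}{2}\lambda_1+\frac12\lambda_2\right)}+q_{i,2}e^{(-1)^{i+1}\sqrt3a\left(\frac{\sqrt3}{2}\lambda_1+\frac12\lambda_2\right)},\qquad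 i=0,1,$$ $$\Lambda(\lambda_1,\lambda_2)=\tfrac12\log\big(g_0(\lambda_1,\lambda_2)\,g_1(\lambda_1,\lambda_2)\big),\qquad \Lambda^*(x,y)=\sup_{(\lambda_1,\lambda_2)\in\mathbb R^2}\{\lambda_1x+\lambda_2y-\Lambda(\lambda_1,\lambda_2)\}.$$ Then $\{(X_n/n,Y_n/n):n\ge1\}$ satisfies the large deviation principle with speed $n$ and good rate function $\Lambda^*$. That is, $\Lambda^*:\mathbb R^2\to[0,\infty]$ is lower semicontinuous, its level sets $\{\Lambda^*\le\eta\}$, $\eta\ge0$, are compact, and $$\liminf_{n\to\infty}\frac1n\log\mathbb P\big[(X_n/n,Y_n/n)\in O\big]\ge-\inf_{O}\Lambda^*\quad\text{for every open }O\subseteq\mathbb R^2,$$ $$\limsup_{n\to\infty}\frac1n\log\mathbb P\big[(X_n/n,Y_n/n)\in C\big]\le-\inf_{C}\Lambda^*\quad\text{for every closed }C\subseteq\mathbb R^2,$$ where $\log 0=-\infty$ and $\inf_\emptyset=+\infty$. -/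

import Mathlib

open MeasureTheory Filter Topology
open scoped ENNReal

noncomputable section

/-- The vertices of class `i` of the hexagonal lattice with edge length `a`. -/
def hexVertices (a : ℝ) (i : Fin 2) : Set (ℝ × ℝ) :=
  {z | ∃ j k : ℤ, z = (3 / 2 * a * (j : ℝ) + ((i : ℕ) : ℝ) * a,
    √3 / 2 * a * (j : ℝ) + √3 * a * (k : ℝ))}

/-- The `r`-th of the three displacements from a vertex of class `i` to an adjacent vertex. -/
def hexStep (a : ℝ) (i : Fin 2) (r : Fin 3) : ℝ × ℝ :=
  (a * Real.cos (((r : ℕ) : ℝ) * (2 / 3 * Real.pi) + ((i : ℕ) : ℝ) * Real.pi),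
   a * Real.sin (((r : ℕ) : ℝ) * (2 / 3 * Real.pi) + ((i : ℕ) : ℝ) * Real.pi))

/-- `(X n, Y n)` starts at the origin and has the one-step transition probabilities
`ℙ[(X (n+1), Y (n+1)) = z + hexStep a i r | (X n, Y n) = z] = q i r` for `z` of class `i`
(whenever the conditioning event has positive probability). Nothing else is required of the
joint law; in particular every Markov chain with these transition probabilities that starts
at the origin is such a walk. -/
structure IsHexWalk {Ω : Type*} [MeasurableSpace Ω] (P : Measure Ω) (a : ℝ)
    (q : Fin 2 → Fin 3 → ℝ) (X Y : ℕ → Ω → ℝ) : Prop where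
  measurable_fst : ∀ n, Measurable (X n)
  measurable_snd : ∀ n, Measurable (Y n)
  initial : P {ω | (X 0 ω, Y 0 ω) = (0, 0)} = 1
  transition : ∀ (n : ℕ) (i : Fin 2) (r : Fin 3), ∀ z ∈ hexVertices a i,
    P {ω | (X n ω, Y n ω) = z} ≠ 0 →
    ProbabilityTheory.cond P {ω | (X n ω, Y n ω) = z}
      {ω | (X (n + 1) ω, Y (n + 1) ω) = z + hexStep a i r} = ENNReal.ofReal (q i r)

/-- A rate function: lower semicontinuous with values in `[0, ∞]`. -/
structure IsRateFunction {Z : Type*} [TopologicalSpace Z] (I : Z → EReal) : Prop where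
  nonneg : ∀ z, 0 ≤ I z
  lowerSemicontinuous : LowerSemicontinuous I

/-- A good rate function: one with compact level sets. -/
structure IsGoodRateFunction {Z : Type*} [TopologicalSpace Z] (I : Z → EReal) : Prop
    extends IsRateFunction I where
  isCompact_level : ∀ η : ℝ, 0 ≤ η → IsCompact {z | I z ≤ (η : EReal)}

/-- The random variables `W n`, `n ≥ 1`, satisfy the large deviation principle with speed `v`
and rate function `I`. Here `ENNReal.log 0 = -∞`. -/
structure SatisfiesLDP {Ω Z : Type*} [MeasurableSpace Ω] [TopologicalSpace Z]
    [MeasurableSpace Z] (P : Measure Ω) (W : ℕ → Ω → Z) (v : ℕ → ℝ) (I : Z → EReal) :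
    Prop where
  measurable : ∀ n, 1 ≤ n → Measurable (W n)
  speed_pos : ∀ n, 1 ≤ n → 0 < v n
  speed_tendsto : Tendsto v atTop atTop
  rate : IsRateFunction I
  lower : ∀ O : Set Z, IsOpen O →
    -(⨅ z ∈ O, I z) ≤
      liminf (fun n => ((1 / v n : ℝ) : EReal) * ENNReal.log (P {ω | W n ω ∈ O})) atTop
  upper : ∀ C : Set Z, IsClosed C →
    limsup (fun n => ((1 / v n : ℝ) : EReal) * ENNReal.log (P {ω | W n ω ∈ C})) atTop ≤
      -(⨅ z ∈ C, I z)

/-- The exponential trinomials `g_i`. -/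
def hexG (a : ℝ) (q : Fin 2 → Fin 3 → ℝ) (i : Fin 2) (l₁ l₂ : ℝ) : ℝ :=
  q i 0
    + q i 1 * Real.exp ((-1) ^ (i : ℕ) * √3 * a * (-(√3 / 2) * l₁ + 1 / 2 * l₂))
    + q i 2 * Real.exp ((-1) ^ ((i : ℕ) + 1) * √3 * a * (√3 / 2 * l₁ + 1 / 2 * l₂))

/-- `Λ = ½ log (g₀ g₁)`. -/
def hexLambda (a : ℝ) (q : Fin 2 → Fin 3 → ℝ) (l₁ l₂ : ℝ) : ℝ :=
  1 / 2 * Real.log (hexG a q 0 l₁ l₂ * hexG a q 1 l₁ l₂)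

/-- The Legendre transform of a real function on the plane, with values in `[-∞, ∞]`. -/
def legendre (L : ℝ → ℝ → ℝ) (z : ℝ × ℝ) : EReal :=
  ⨆ l : ℝ × ℝ, ((l.1 * z.1 + l.2 * z.2 - L l.1 l.2 : ℝ) : EReal)

end

/-! Each step changes the vertex class, so at time `n` the walk is almost surely in class `n` mod 2.
The one-step probabilities then determine the law of each position recursively (no Markov property
is needed): it is the law of a sum of `n` independent steps whose distributions alternate with
period two. `walkExp` is the expectation under this law, and `IsHexWalk.measureReal_eq_walkExp`
makes the identification. The moment generating function of the sum is a product alternating between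
two factors, hence `exp (n Λ)` up to a constant factor.

Upper bound: the walk divided by `n` stays in a fixed ball, so a closed set may be replaced by a
compact one. That set is covered by finitely many half planes, each satisfying a Chernoff bound.

Lower bound: tilting the steps by `exp (l · z)` makes the walk concentrate, by Chebyshev, at speed
`∇Λ(l)`; undoing the tilt costs `l · ∇Λ(l) - Λ(l)` per step. Since some `q i r` may vanish, a point
`x` with finite `Λ*(x)` need not be a gradient. Minimising `Λ(l) + ε/2 |l|² - l · x` yields a
gradient `x - ε l` close to `x` with no larger cost than `Λ*(x)` (`exists_hexMean_near`). This
replaces any discussion of steepness or relative interiors. -/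

/-! ### Geometry of the hexagonal lattice. -/

lemma hexStep_eq (a : ℝ) (i : Fin 2) (r : Fin 3) :
    hexStep a i r = ((-1) ^ (i : ℕ) * a * (![1, -1 / 2, -1 / 2] : Fin 3 → ℝ) r,
      (-1) ^ (i : ℕ) * a * (![0, √3 / 2, -√3 / 2] : Fin 3 → ℝ) r) := by
  have e1 : 2 / 3 * Real.pi = Real.pi - Real.pi / 3 := by ring
  have e2 : 2 * (2 / 3 * Real.pi) = Real.pi / 3 + Real.pi := by ring
  have c1 : Real.cos (2 / 3 * Real.pi) = -1 / 2 := by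
    rw [e1, Real.cos_pi_sub, Real.cos_pi_div_three]; norm_num
  have s1 : Real.sin (2 / 3 * Real.pi) = √3 / 2 := by
    rw [e1, Real.sin_pi_sub, Real.sin_pi_div_three]
  have c2 : Real.cos (2 * (2 / 3 * Real.pi)) = -1 / 2 := by
    rw [e2, Real.cos_add_pi, Real.cos_pi_div_three]; norm_num
  have s2 : Real.sin (2 * (2 / 3 * Real.pi)) = -√3 / 2 := by
    rw [e2, Real.sin_add_pi, Real.sin_pi_div_three]; ring
  fin_cases i <;> fin_cases r <;>
    simp [hexStep, c1, s1, c2, s2, Real.cos_add_pi, Real.sin_add_pi]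

lemma hexStep_injective {a : ℝ} (ha : 0 < a) (i : Fin 2) :
    Function.Injective (hexStep a i) := by
  have h3 : (0 : ℝ) < √3 := by positivity
  intro r r' h
  rw [hexStep_eq, hexStep_eq, Prod.mk.injEq] at h
  obtain ⟨h1, h2⟩ := h
  have hne : ((-1 : ℝ) ^ (i : ℕ) * a) ≠ 0 := by positivity
  have h1 := mul_left_cancel₀ hne h1
  have h2 := mul_left_cancel₀ hne h2
  fin_cases r <;> fin_cases r' <;> simp at h1 h2 ⊢ <;> linarith

lemma add_hexStep_mem_hexVertices {a : ℝ} {i : Fin 2} (r : Fin 3) {z : ℝ × ℝ}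
    (hz : z ∈ hexVertices a i) : z + hexStep a i r ∈ hexVertices a (i + 1) := by
  obtain ⟨j, k, rfl⟩ := hz
  rw [hexStep_eq]
  have key : ∃ j' k' : ℤ,
      (3 / 2 * a * (j : ℝ) + ((i : ℕ) : ℝ) * a +
          (-1) ^ (i : ℕ) * a * (![1, -1 / 2, -1 / 2] : Fin 3 → ℝ) r =
        3 / 2 * a * (j' : ℝ) + (((i + 1 : Fin 2) : ℕ) : ℝ) * a) ∧
      (√3 / 2 * a * (j : ℝ) + √3 * a * (k : ℝ) +
          (-1) ^ (i : ℕ) * a * (![0, √3 / 2, -√3 / 2] : Fin 3 → ℝ) r =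
        √3 / 2 * a * (j' : ℝ) + √3 * a * (k' : ℝ)) := by
    refine ⟨j + (![![0, -1, -1], ![0, 1, 1]] : Fin 2 → Fin 3 → ℤ) i r,
      k + (![![0, 1, 0], ![0, -1, 0]] : Fin 2 → Fin 3 → ℤ) i r, ?_⟩
    fin_cases i <;> fin_cases r <;> simp <;> constructor <;> ring
  obtain ⟨j', k', h1, h2⟩ := key
  exact ⟨j', k', Prod.ext h1 h2⟩

lemma countable_hexVertices (a : ℝ) (i : Fin 2) : (hexVertices a i).Countable := by
  refine (Set.countable_range (fun p : ℤ × ℤ => ((3 / 2 * a * (p.1 : ℝ) + ((i : ℕ) : ℝ) * a,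
    √3 / 2 * a * (p.1 : ℝ) + √3 * a * (p.2 : ℝ)) : ℝ × ℝ))).mono ?_
  rintro z ⟨j, k, rfl⟩
  exact ⟨(j, k), rfl⟩

lemma zero_mem_hexVertices (a : ℝ) : (0 : ℝ × ℝ) ∈ hexVertices a 0 :=
  ⟨0, 0, by simp; rfl⟩

lemma fin_two_ofNat_succ (n : ℕ) : Fin.ofNat 2 (n + 1) = Fin.ofNat 2 n + 1 := by
  ext; simp [Fin.ofNat, Fin.val_add]

/-! ### One-step recursion for the law of the position. -/

namespace IsHexWalk

variable {Ω : Type*} [MeasurableSpace Ω] {P : Measure Ω} {a : ℝ}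
  {q : Fin 2 → Fin 3 → ℝ} {X Y : ℕ → Ω → ℝ}

lemma measurable_pair (h : IsHexWalk P a q X Y) (n : ℕ) :
    Measurable (fun ω => (X n ω, Y n ω)) :=
  (h.measurable_fst n).prodMk (h.measurable_snd n)

lemma measure_eq_inter_step [IsProbabilityMeasure P] (h : IsHexWalk P a q X Y) {n : ℕ} {i : Fin 2} (r : Fin 3)
    {z : ℝ × ℝ} (hz : z ∈ hexVertices a i) :
    P {ω | (X n ω, Y n ω) = z ∧ (X (n + 1) ω, Y (n + 1) ω) = (X n ω, Y n ω) + hexStep a i r} =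
      ENNReal.ofReal (q i r) * P {ω | (X n ω, Y n ω) = z} := by
  have hm : MeasurableSet {ω | (X n ω, Y n ω) = z} :=
    h.measurable_pair n (measurableSet_singleton z)
  have hset : {ω | (X n ω, Y n ω) = z ∧
        (X (n + 1) ω, Y (n + 1) ω) = (X n ω, Y n ω) + hexStep a i r} =
      {ω | (X n ω, Y n ω) = z} ∩ {ω | (X (n + 1) ω, Y (n + 1) ω) = z + hexStep a i r} := by
    ext ω
    simp only [Set.mem_ofPred_eq, Set.mem_inter_iff]
    constructor
    · rintro ⟨h1, h2⟩
      exact ⟨h1, h2.trans (by rw [h1])⟩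
    · rintro ⟨h1, h2⟩
      exact ⟨h1, h2.trans (by rw [h1])⟩
  rw [hset]
  -- At a null vertex the transition hypothesis says nothing, but both sides vanish.
  by_cases h0 : P {ω | (X n ω, Y n ω) = z} = 0
  · rw [h0, mul_zero]
    exact measure_mono_null Set.inter_subset_left h0
  · rw [← h.transition n i r z hz h0, ProbabilityTheory.cond_mul_eq_inter hm]

/-- The step is independent of the position: the lattice is countable, so the identity at single
vertices can be summed over `S`. -/
lemma measure_mem_inter_step [IsProbabilityMeasure P] (h : IsHexWalk P a q X Y) {n : ℕ} {i : Fin 2} (r : Fin 3)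
    (hn : ∀ᵐ ω ∂P, (X n ω, Y n ω) ∈ hexVertices a i) (S : Set (ℝ × ℝ)) :
    P {ω | (X n ω, Y n ω) ∈ S ∧
        (X (n + 1) ω, Y (n + 1) ω) = (X n ω, Y n ω) + hexStep a i r} =
      ENNReal.ofReal (q i r) * P {ω | (X n ω, Y n ω) ∈ S} := by
  have hc : (S ∩ hexVertices a i).Countable :=
    (countable_hexVertices a i).mono Set.inter_subset_right
  have e1 : P {ω | (X n ω, Y n ω) ∈ S} =
      P (⋃ z ∈ S ∩ hexVertices a i, {ω | (X n ω, Y n ω) = z}) := by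
    refine measure_congr (eventuallyEq_set.2 ?_)
    filter_upwards [hn] with ω hω
    simp [hω]
  have e2 : P {ω | (X n ω, Y n ω) ∈ S ∧
        (X (n + 1) ω, Y (n + 1) ω) = (X n ω, Y n ω) + hexStep a i r} =
      P (⋃ z ∈ S ∩ hexVertices a i, {ω | (X n ω, Y n ω) = z ∧
        (X (n + 1) ω, Y (n + 1) ω) = (X n ω, Y n ω) + hexStep a i r}) := by
    refine measure_congr (eventuallyEq_set.2 ?_)
    filter_upwards [hn] with ω hω
    simp [hω]
  have hm : ∀ z, MeasurableSet {ω | (X n ω, Y n ω) = z} := fun z =>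
    h.measurable_pair n (measurableSet_singleton z)
  have hm' : MeasurableSet
      {ω | (X (n + 1) ω, Y (n + 1) ω) = (X n ω, Y n ω) + hexStep a i r} :=
    measurableSet_eq_fun (h.measurable_pair (n + 1)) ((h.measurable_pair n).add_const _)
  rw [e1, e2, measure_biUnion hc, measure_biUnion hc, ← ENNReal.tsum_mul_left]
  · exact tsum_congr fun z => h.measure_eq_inter_step r z.2.2
  · intro z _ z' _ hne
    exact Set.disjoint_left.2 fun ω h1 h2 => hne (h1.symm.trans h2)
  · exact fun z _ => hm z
  · intro z _ z' _ hne
    exact Set.disjoint_left.2 fun ω h1 h2 => hne (h1.1.symm.trans h2.1)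
  · exact fun z _ => (hm z).inter hm'

/-- The three step events are disjoint, because the displacements are distinct, and their
probabilities `q i r` add up to 1. -/
lemma ae_exists_step [IsProbabilityMeasure P] (h : IsHexWalk P a q X Y) (ha : 0 < a) (hq : ∀ i r, 0 ≤ q i r)
    (hq1 : ∀ i, ∑ r, q i r = 1) {n : ℕ} {i : Fin 2}
    (hn : ∀ᵐ ω ∂P, (X n ω, Y n ω) ∈ hexVertices a i) :
    ∀ᵐ ω ∂P, ∃ r, (X (n + 1) ω, Y (n + 1) ω) = (X n ω, Y n ω) + hexStep a i r := by
  have hm' : ∀ r, MeasurableSet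
      {ω | (X (n + 1) ω, Y (n + 1) ω) = (X n ω, Y n ω) + hexStep a i r} := fun r =>
    measurableSet_eq_fun (h.measurable_pair (n + 1)) ((h.measurable_pair n).add_const _)
  have hset : {ω | ∃ r, (X (n + 1) ω, Y (n + 1) ω) = (X n ω, Y n ω) + hexStep a i r} =
      ⋃ r, {ω | (X (n + 1) ω, Y (n + 1) ω) = (X n ω, Y n ω) + hexStep a i r} := by
    ext ω; simp
  refine (mem_ae_iff_prob_eq_one (by rw [hset]; exact MeasurableSet.iUnion hm')).2 ?_
  rw [hset, measure_iUnion _ hm', tsum_fintype]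
  · have e : ∀ r, P {ω | (X (n + 1) ω, Y (n + 1) ω) = (X n ω, Y n ω) + hexStep a i r} =
        ENNReal.ofReal (q i r) := fun r => by
      simpa using h.measure_mem_inter_step r hn Set.univ
    rw [Finset.sum_congr rfl fun r _ => e r, ← ENNReal.ofReal_sum_of_nonneg fun r _ => hq i r,
      hq1, ENNReal.ofReal_one]
  · intro r r' hne
    refine Set.disjoint_left.2 fun ω h1 h2 => hne ?_
    exact hexStep_injective ha i (add_left_cancel (Eq.trans (Eq.symm h1) h2))

lemma measureReal_succ [IsProbabilityMeasure P] (h : IsHexWalk P a q X Y) (ha : 0 < a) (hq : ∀ i r, 0 ≤ q i r)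
    (hq1 : ∀ i, ∑ r, q i r = 1) {n : ℕ} {i : Fin 2}
    (hn : ∀ᵐ ω ∂P, (X n ω, Y n ω) ∈ hexVertices a i) {B : Set (ℝ × ℝ)}
    (hB : MeasurableSet B) :
    P.real {ω | (X (n + 1) ω, Y (n + 1) ω) ∈ B} =
      ∑ r, q i r * P.real {ω | (X n ω, Y n ω) + hexStep a i r ∈ B} := by
  have hm' : ∀ r, MeasurableSet
      {ω | (X (n + 1) ω, Y (n + 1) ω) = (X n ω, Y n ω) + hexStep a i r} := fun r =>
    measurableSet_eq_fun (h.measurable_pair (n + 1)) ((h.measurable_pair n).add_const _)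
  have e : P {ω | (X (n + 1) ω, Y (n + 1) ω) ∈ B} =
      P (⋃ r, {ω | (X n ω, Y n ω) + hexStep a i r ∈ B ∧
        (X (n + 1) ω, Y (n + 1) ω) = (X n ω, Y n ω) + hexStep a i r}) := by
    refine measure_congr (eventuallyEq_set.2 ?_)
    filter_upwards [h.ae_exists_step ha hq hq1 hn] with ω hω
    simp only [Set.mem_iUnion, Set.mem_ofPred_eq]
    constructor
    · rintro h1
      obtain ⟨r, hr⟩ := hω
      exact ⟨r, hr ▸ h1, hr⟩
    · rintro ⟨r, h1, h2⟩
      rwa [h2]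
  rw [measureReal_def, e, measure_iUnion, tsum_fintype, ENNReal.toReal_sum]
  · refine Finset.sum_congr rfl fun r _ => ?_
    have := h.measure_mem_inter_step r hn {z | z + hexStep a i r ∈ B}
    simp only [Set.mem_ofPred_eq] at this
    rw [this, ENNReal.toReal_mul, ENNReal.toReal_ofReal (hq i r), measureReal_def]
  · exact fun r _ => measure_ne_top _ _
  · intro r r' hne
    refine Set.disjoint_left.2 fun ω h1 h2 => hne ?_
    exact hexStep_injective ha i (add_left_cancel (h1.2.symm.trans h2.2))
  · exact fun r => (((h.measurable_pair n).add_const _) hB).inter (hm' r)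

lemma ae_mem_hexVertices [IsProbabilityMeasure P] (h : IsHexWalk P a q X Y) (ha : 0 < a)
    (hq : ∀ i r, 0 ≤ q i r) (hq1 : ∀ i, ∑ r, q i r = 1) (n : ℕ) :
    ∀ᵐ ω ∂P, (X n ω, Y n ω) ∈ hexVertices a (Fin.ofNat 2 n) := by
  induction n with
  | zero =>
    have hm := h.measurable_pair 0 (measurableSet_singleton (0, 0))
    filter_upwards [(mem_ae_iff_prob_eq_one hm).2 h.initial] with ω hω
    have hω : (X 0 ω, Y 0 ω) = (0, 0) := hω
    rw [hω]
    exact zero_mem_hexVertices a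
  | succ n ih =>
    filter_upwards [ih, h.ae_exists_step ha hq hq1 ih] with ω h1 h2
    obtain ⟨r, hr⟩ := h2
    rw [hr, fin_two_ofNat_succ]
    exact add_hexStep_mem_hexVertices r h1

end IsHexWalk

/-! ### Sums of independent finitely supported steps, as linear functionals. -/

section WalkExpectation

variable {ι E : Type*} [Fintype ι] [AddCommMonoid E]

/-- The expectation functional of the `n`-th position of a walk started at `0` whose `k`-th step
is `s k r` with weight `w k r`, independently of the other steps. -/
noncomputable def walkExp (w : ℕ → ι → ℝ) (s : ℕ → ι → E) : ℕ → ((E → ℝ) →ₗ[ℝ] ℝ)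
  | 0 => LinearMap.proj 0
  | n + 1 => walkExp w s n ∘ₗ ∑ r, w n r • LinearMap.funLeft ℝ ℝ (· + s n r)

variable {w : ℕ → ι → ℝ} {s : ℕ → ι → E}

lemma walkExp_zero (f : E → ℝ) : walkExp w s 0 f = f 0 := rfl

/-- This averages over the last step inside the functional; `walkExp_succ'` takes the same average
outside it. -/
lemma walkExp_succ (n : ℕ) (f : E → ℝ) :
    walkExp w s (n + 1) f = walkExp w s n (fun z => ∑ r, w n r * f (z + s n r)) := by
  simp only [walkExp, LinearMap.comp_apply]
  congr 1
  ext z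
  simp [LinearMap.sum_apply, Finset.sum_apply, LinearMap.funLeft_apply]

lemma walkExp_succ' (n : ℕ) (f : E → ℝ) :
    walkExp w s (n + 1) f = ∑ r, w n r * walkExp w s n (fun z => f (z + s n r)) := by
  simp only [walkExp, LinearMap.comp_apply, LinearMap.sum_apply, map_sum, LinearMap.smul_apply,
    map_smul, smul_eq_mul]
  rfl

lemma walkExp_mono (hw : ∀ n r, 0 ≤ w n r) (n : ℕ) {f g : E → ℝ} (hfg : f ≤ g) :
    walkExp w s n f ≤ walkExp w s n g := by
  induction n generalizing f g with
  | zero => exact hfg 0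
  | succ n ih =>
    rw [walkExp_succ', walkExp_succ']
    exact Finset.sum_le_sum fun r _ =>
      mul_le_mul_of_nonneg_left (ih fun z => hfg _) (hw n r)

lemma walkExp_const (hw1 : ∀ n, ∑ r, w n r = 1) (n : ℕ) (c : ℝ) :
    walkExp w s n (fun _ => c) = c := by
  induction n with
  | zero => rfl
  | succ n ih => rw [walkExp_succ', ← Finset.sum_mul, hw1, one_mul, ih]

/-- Exponential change of measure. -/
lemma walkExp_mul_eq_prod_mul {χ : E → ℝ} (hχ0 : χ 0 = 1) (hχ : ∀ x y, χ (x + y) = χ x * χ y)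
    {M : ℕ → ℝ} (hM : ∀ n, M n ≠ 0) (n : ℕ) (f : E → ℝ) :
    walkExp w s n (fun z => χ z * f z) =
      (∏ k ∈ Finset.range n, M k) * walkExp (fun k r => w k r * χ (s k r) / M k) s n f := by
  induction n generalizing f with
  | zero => simp [walkExp_zero, hχ0]
  | succ n ih =>
    rw [walkExp_succ, walkExp_succ, Finset.prod_range_succ, mul_assoc, ← smul_eq_mul (M n),
      ← map_smul, ← ih]
    congr 1
    ext z
    simp only [Pi.smul_apply, smul_eq_mul, Finset.mul_sum, hχ]
    refine Finset.sum_congr rfl fun r _ => ?_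
    field_simp [hM n]

lemma walkExp_exp {χ : E → ℝ} (hχ0 : χ 0 = 1) (hχ : ∀ x y, χ (x + y) = χ x * χ y) (n : ℕ) :
    walkExp w s n χ = ∏ k ∈ Finset.range n, ∑ r, w k r * χ (s k r) := by
  induction n with
  | zero => simp [walkExp_zero, hχ0]
  | succ n ih =>
    rw [walkExp_succ, Finset.prod_range_succ, mul_comm, ← smul_eq_mul, ← ih, ← map_smul]
    congr 1
    ext z
    simp only [Pi.smul_apply, smul_eq_mul, Finset.sum_mul, hχ]
    exact Finset.sum_congr rfl fun r _ => by ring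

/-- The variance of an additive function of the walk is the sum of the variances of the steps. -/
lemma walkExp_sq_sub (hw1 : ∀ n, ∑ r, w n r = 1) (φ : E →+ ℝ) (n : ℕ) :
    walkExp w s n (fun z => (φ z - ∑ k ∈ Finset.range n, ∑ r, w k r * φ (s k r)) ^ 2) =
      ∑ k ∈ Finset.range n, ∑ r, w k r * (φ (s k r) - ∑ r, w k r * φ (s k r)) ^ 2 := by
  induction n with
  | zero => simp [walkExp_zero]
  | succ n ih =>
    rw [walkExp_succ, Finset.sum_range_succ
      (fun k => ∑ r, w k r * (φ (s k r) - ∑ r, w k r * φ (s k r)) ^ 2) n, ← ih,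
      ← walkExp_const (w := w) (s := s) hw1 n
        (∑ r, w n r * (φ (s n r) - ∑ r, w n r * φ (s n r)) ^ 2), ← map_add]
    congr 1
    ext z
    simp only [Pi.add_apply, Finset.sum_range_succ _ n, map_add]
    generalize φ z = x
    generalize ∑ k ∈ Finset.range n, ∑ r, w k r * φ (s k r) = c
    set m := ∑ r, w n r * φ (s n r) with hm
    have e : ∀ r, w n r * (x + φ (s n r) - (c + m)) ^ 2 =
        (x - c) ^ 2 * w n r + 2 * (x - c) * (w n r * φ (s n r)) - 2 * (x - c) * m * w n r +
          w n r * (φ (s n r) - m) ^ 2 := fun r => by ring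
    -- The cross terms cancel because `m` is the mean of the new step.
    simp only [e, Finset.sum_add_distrib, Finset.sum_sub_distrib, ← Finset.mul_sum, hw1, ← hm]
    ring

end WalkExpectation

/-! ### Period-two averages and identification of the law. -/

lemma sum_range_fin_two (x : Fin 2 → ℝ) (n : ℕ) :
    ∑ k ∈ Finset.range n, x (Fin.ofNat 2 k) =
      n * ((x 0 + x 1) / 2) + if (Fin.ofNat 2 n) = 0 then 0 else (x 0 - x 1) / 2 := by
  induction n with
  | zero => simp
  | succ n ih =>
    rw [Finset.sum_range_succ, ih, fin_two_ofNat_succ, Nat.cast_succ (R := ℝ)]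
    generalize (Fin.ofNat 2 n) = j
    fin_cases j <;> simp <;> ring

/-- The error is bounded uniformly in `n`, so alternating sums count as `n` times the average on the
exponential scale. -/
lemma abs_sum_range_fin_two_sub_le (x : Fin 2 → ℝ) (n : ℕ) :
    |∑ k ∈ Finset.range n, x (Fin.ofNat 2 k) - n * ((x 0 + x 1) / 2)| ≤ |(x 0 - x 1) / 2| := by
  rw [sum_range_fin_two, add_sub_cancel_left]
  split_ifs
  · simp
  · exact le_rfl

lemma IsHexWalk.measureReal_eq_walkExp {Ω : Type*} [MeasurableSpace Ω] {P : Measure Ω} {a : ℝ}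
    {q : Fin 2 → Fin 3 → ℝ} {X Y : ℕ → Ω → ℝ} [IsProbabilityMeasure P]
    (h : IsHexWalk P a q X Y) (ha : 0 < a)
    (hq : ∀ i r, 0 ≤ q i r) (hq1 : ∀ i, ∑ r, q i r = 1) (n : ℕ) {B : Set (ℝ × ℝ)}
    (hB : MeasurableSet B) :
    P.real {ω | (X n ω, Y n ω) ∈ B} =
      walkExp (fun k => q (Fin.ofNat 2 k)) (fun k => hexStep a (Fin.ofNat 2 k)) n (B.indicator 1) := by
  induction n generalizing B with
  | zero =>
    rw [walkExp_zero]
    have h0 : ∀ᵐ ω ∂P, (X 0 ω, Y 0 ω) = (0, 0) :=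
      (mem_ae_iff_prob_eq_one (h.measurable_pair 0 (measurableSet_singleton (0, 0)))).2 h.initial
    have : P.real {ω | (X 0 ω, Y 0 ω) ∈ B} = P.real {_ω | (0 : ℝ × ℝ) ∈ B} := by
      refine measureReal_congr (eventuallyEq_set.2 ?_)
      filter_upwards [h0] with ω hω
      have hω' : (X 0 ω, Y 0 ω) = (0 : ℝ × ℝ) := hω
      simp only [hω']
    rw [this]
    by_cases hB0 : (0 : ℝ × ℝ) ∈ B <;> simp [hB0]
  | succ n ih =>
    rw [h.measureReal_succ ha hq hq1 (h.ae_mem_hexVertices ha hq hq1 n) hB, walkExp_succ']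
    refine Finset.sum_congr rfl fun r _ => ?_
    congr 1
    have hB' : MeasurableSet {z : ℝ × ℝ | z + hexStep a (Fin.ofNat 2 n) r ∈ B} :=
      (measurable_id.add_const _) hB
    exact ih hB'

/-! ### Moment generating functions, tilting and the function Λ. -/

/-- The character `z ↦ exp (l · z)` of the plane. -/
noncomputable def planeChar (l z : ℝ × ℝ) : ℝ := Real.exp (l.1 * z.1 + l.2 * z.2)

lemma planeChar_pos (l z : ℝ × ℝ) : 0 < planeChar l z := Real.exp_pos _

lemma planeChar_zero (l : ℝ × ℝ) : planeChar l 0 = 1 := by simp [planeChar]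

lemma planeChar_add (l x y : ℝ × ℝ) : planeChar l (x + y) = planeChar l x * planeChar l y := by
  rw [planeChar, planeChar, planeChar, ← Real.exp_add]
  congr 1
  simp only [Prod.fst_add, Prod.snd_add]
  ring

/-- The moment generating function of a step of the walk from a vertex of class `i`. -/
noncomputable def hexMgf (a : ℝ) (q : Fin 2 → Fin 3 → ℝ) (i : Fin 2) (l : ℝ × ℝ) : ℝ :=
  ∑ r, q i r * planeChar l (hexStep a i r)

/-- The exponentially tilted transition probabilities. -/
noncomputable def hexTilt (a : ℝ) (q : Fin 2 → Fin 3 → ℝ) (l : ℝ × ℝ) (i : Fin 2) (r : Fin 3) :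
    ℝ :=
  q i r * planeChar l (hexStep a i r) / hexMgf a q i l

/-- The average over both vertex classes of the mean of `φ` over a tilted step. -/
noncomputable def hexMean (a : ℝ) (q : Fin 2 → Fin 3 → ℝ) (l : ℝ × ℝ) (φ : ℝ × ℝ → ℝ) : ℝ :=
  (∑ r, hexTilt a q l 0 r * φ (hexStep a 0 r) + ∑ r, hexTilt a q l 1 r * φ (hexStep a 1 r)) / 2

section

variable {a : ℝ} {q : Fin 2 → Fin 3 → ℝ}

lemma hexMgf_pos (hq : ∀ i r, 0 ≤ q i r) (hq1 : ∀ i, ∑ r, q i r = 1) (i : Fin 2) (l : ℝ × ℝ) :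
    0 < hexMgf a q i l := by
  refine Finset.sum_pos' (fun r _ => mul_nonneg (hq i r) (planeChar_pos _ _).le) ?_
  by_contra! hcon
  have : ∑ r, q i r = 0 := by
    refine Finset.sum_eq_zero fun r hr => le_antisymm ?_ (hq i r)
    by_contra! hlt
    exact (mul_pos hlt (planeChar_pos l (hexStep a i r))).not_ge (hcon r hr)
  rw [hq1] at this
  exact one_ne_zero this

lemma hexTilt_nonneg (hq : ∀ i r, 0 ≤ q i r) (hq1 : ∀ i, ∑ r, q i r = 1) (l : ℝ × ℝ)
    (i : Fin 2) (r : Fin 3) : 0 ≤ hexTilt a q l i r :=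
  div_nonneg (mul_nonneg (hq i r) (planeChar_pos _ _).le) (hexMgf_pos hq hq1 i l).le

lemma sum_hexTilt (hq : ∀ i r, 0 ≤ q i r) (hq1 : ∀ i, ∑ r, q i r = 1) (l : ℝ × ℝ)
    (i : Fin 2) : ∑ r, hexTilt a q l i r = 1 := by
  simp only [hexTilt, ← Finset.sum_div]
  exact div_self (hexMgf_pos hq hq1 i l).ne'

/-- The displacement `r = 0` is factored out. The prefactors of the two classes are inverse to each
other, so `hexLambda` is unchanged if `hexG` is replaced by `hexMgf`. -/
lemma hexMgf_eq_mul_hexG (i : Fin 2) (l : ℝ × ℝ) :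
    hexMgf a q i l = Real.exp ((-1) ^ (i : ℕ) * a * l.1) * hexG a q i l.1 l.2 := by
  have h3 : √3 * √3 = 3 := Real.mul_self_sqrt (by norm_num)
  rw [hexMgf, Fin.sum_univ_three, hexG]
  simp only [planeChar, hexStep_eq, mul_add]
  rw [mul_left_comm (Real.exp _) (q i 1), mul_left_comm (Real.exp _) (q i 2), ← Real.exp_add,
    ← Real.exp_add, mul_comm (Real.exp _) (q i 0)]
  congr 1
  · congr 1
    · congr 2
      simp; ring
    · congr 2
      simp only [Matrix.cons_val_one, Matrix.cons_val_zero]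
      linear_combination (1 / 2 * (-1) ^ (i : ℕ) * a * l.1) * h3
  · congr 2
    simp only [Matrix.cons_val]
    linear_combination (1 / 2 * (-1) ^ (i : ℕ) * a * l.1) * h3

lemma hexLambda_eq (hq : ∀ i r, 0 ≤ q i r) (hq1 : ∀ i, ∑ r, q i r = 1) (l : ℝ × ℝ) :
    hexLambda a q l.1 l.2 = (Real.log (hexMgf a q 0 l) + Real.log (hexMgf a q 1 l)) / 2 := by
  rw [hexLambda, ← Real.log_mul (hexMgf_pos hq hq1 0 l).ne' (hexMgf_pos hq hq1 1 l).ne',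
    hexMgf_eq_mul_hexG, hexMgf_eq_mul_hexG, mul_mul_mul_comm, ← Real.exp_add]
  simp
  ring

lemma abs_fst_hexStep_le (ha : 0 < a) (i : Fin 2) (r : Fin 3) : |(hexStep a i r).1| ≤ a := by
  rw [hexStep, abs_mul, abs_of_pos ha]
  exact mul_le_of_le_one_right ha.le (Real.abs_cos_le_one _)

lemma abs_snd_hexStep_le (ha : 0 < a) (i : Fin 2) (r : Fin 3) : |(hexStep a i r).2| ≤ a := by
  rw [hexStep, abs_mul, abs_of_pos ha]
  exact mul_le_of_le_one_right ha.le (Real.abs_sin_le_one _)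

lemma log_hexMgf_le (ha : 0 < a) (hq : ∀ i r, 0 ≤ q i r) (hq1 : ∀ i, ∑ r, q i r = 1) (i : Fin 2)
    (l : ℝ × ℝ) : Real.log (hexMgf a q i l) ≤ a * (|l.1| + |l.2|) := by
  rw [Real.log_le_iff_le_exp (hexMgf_pos hq hq1 i l), hexMgf]
  calc ∑ r, q i r * planeChar l (hexStep a i r)
      ≤ ∑ r, q i r * Real.exp (a * (|l.1| + |l.2|)) := by
        refine Finset.sum_le_sum fun r _ => mul_le_mul_of_nonneg_left ?_ (hq i r)
        refine Real.exp_le_exp.2 ?_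
        have h1 := le_abs_self (l.1 * (hexStep a i r).1)
        have h2 := le_abs_self (l.2 * (hexStep a i r).2)
        rw [abs_mul] at h1 h2
        have h3 := mul_le_mul_of_nonneg_left (abs_fst_hexStep_le ha i r) (abs_nonneg l.1)
        have h4 := mul_le_mul_of_nonneg_left (abs_snd_hexStep_le ha i r) (abs_nonneg l.2)
        linarith
    _ = _ := by rw [← Finset.sum_mul, hq1, one_mul]

lemma hexLambda_le (ha : 0 < a) (hq : ∀ i r, 0 ≤ q i r) (hq1 : ∀ i, ∑ r, q i r = 1)
    (l : ℝ × ℝ) : hexLambda a q l.1 l.2 ≤ a * (|l.1| + |l.2|) := by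
  rw [hexLambda_eq hq hq1]
  linarith [log_hexMgf_le ha hq hq1 0 l, log_hexMgf_le ha hq hq1 1 l]

lemma hexLambda_zero (hq : ∀ i r, 0 ≤ q i r) (hq1 : ∀ i, ∑ r, q i r = 1) :
    hexLambda a q 0 0 = 0 := by
  have h : ∀ i, hexMgf a q i (0, 0) = 1 := fun i => by simp [hexMgf, planeChar, hq1]
  have := hexLambda_eq (a := a) hq hq1 (0, 0)
  simpa [h] using this

lemma hasDerivAt_hexMgf (i : Fin 2) (l v : ℝ × ℝ) :
    HasDerivAt (fun t : ℝ => hexMgf a q i (l + t • v))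
      (∑ r, q i r * (planeChar l (hexStep a i r) *
        (v.1 * (hexStep a i r).1 + v.2 * (hexStep a i r).2))) 0 := by
  refine HasDerivAt.fun_sum fun r _ => HasDerivAt.const_mul _ ?_
  have h : HasDerivAt (fun t : ℝ => (l + t • v).1 * (hexStep a i r).1 +
      (l + t • v).2 * (hexStep a i r).2)
      (v.1 * (hexStep a i r).1 + v.2 * (hexStep a i r).2) 0 := by
    simp only [Prod.fst_add, Prod.snd_add, Prod.smul_fst, Prod.smul_snd, smul_eq_mul]
    have h1 : HasDerivAt (fun t : ℝ => l.1 + t * v.1) v.1 0 := by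
      simpa using ((hasDerivAt_id (0 : ℝ)).mul_const v.1).const_add l.1
    have h2 : HasDerivAt (fun t : ℝ => l.2 + t * v.2) v.2 0 := by
      simpa using ((hasDerivAt_id (0 : ℝ)).mul_const v.2).const_add l.2
    exact (h1.mul_const _).add (h2.mul_const _)
  simpa [planeChar] using h.exp

/-- Logarithmic differentiation of a moment generating function gives the tilted mean, so the
`hexMean` of the two coordinates is the gradient of Λ. -/
lemma hasDerivAt_hexLambda (hq : ∀ i r, 0 ≤ q i r) (hq1 : ∀ i, ∑ r, q i r = 1) (l v : ℝ × ℝ) :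
    HasDerivAt (fun t : ℝ => hexLambda a q (l + t • v).1 (l + t • v).2)
      (hexMean a q l fun z => v.1 * z.1 + v.2 * z.2) 0 := by
  have hlog : ∀ i, HasDerivAt (fun t : ℝ => Real.log (hexMgf a q i (l + t • v)))
      (∑ r, hexTilt a q l i r * (v.1 * (hexStep a i r).1 + v.2 * (hexStep a i r).2)) 0 := by
    intro i
    have h := (hasDerivAt_hexMgf (a := a) (q := q) i l v).log
      (by simpa using (hexMgf_pos hq hq1 i l).ne')
    convert h using 1
    rw [Finset.sum_div]
    refine Finset.sum_congr rfl fun r _ => ?_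
    simp only [hexTilt, zero_smul, add_zero]
    ring
  simp only [hexLambda_eq hq hq1]
  exact ((hlog 0).add (hlog 1)).div_const 2

lemma continuous_hexLambda (hq : ∀ i r, 0 ≤ q i r) (hq1 : ∀ i, ∑ r, q i r = 1) :
    Continuous fun l : ℝ × ℝ => hexLambda a q l.1 l.2 := by
  have h : ∀ i, Continuous (hexMgf a q i) := fun i => by
    unfold hexMgf planeChar
    fun_prop
  simp only [hexLambda_eq hq hq1]
  exact (((h 0).log fun l => (hexMgf_pos hq hq1 0 l).ne').add
    ((h 1).log fun l => (hexMgf_pos hq hq1 1 l).ne')).div_const 2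

lemma prod_hexMgf_bounds (hq : ∀ i r, 0 ≤ q i r) (hq1 : ∀ i, ∑ r, q i r = 1) (l : ℝ × ℝ) :
    ∃ D : ℝ, ∀ n : ℕ,
      Real.exp (n * hexLambda a q l.1 l.2 - D) ≤
        ∏ k ∈ Finset.range n, hexMgf a q (Fin.ofNat 2 k) l ∧
      ∏ k ∈ Finset.range n, hexMgf a q (Fin.ofNat 2 k) l ≤
        Real.exp (n * hexLambda a q l.1 l.2 + D) := by
  refine ⟨|(Real.log (hexMgf a q 0 l) - Real.log (hexMgf a q 1 l)) / 2|, fun n => ?_⟩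
  have h := abs_le.1 (abs_sum_range_fin_two_sub_le (fun i => Real.log (hexMgf a q i l)) n)
  rw [← hexLambda_eq hq hq1] at h
  have e : ∏ k ∈ Finset.range n, hexMgf a q (Fin.ofNat 2 k) l =
      Real.exp (∑ k ∈ Finset.range n, Real.log (hexMgf a q (Fin.ofNat 2 k) l)) := by
    rw [Real.exp_sum]
    exact Finset.prod_congr rfl fun k _ => (Real.exp_log (hexMgf_pos hq hq1 _ l)).symm
  rw [e, Real.exp_le_exp, Real.exp_le_exp]
  constructor
  · linarith [h.1]
  · linarith [h.2]

/-- A point at which the Legendre transform is finite is approximated by gradients. -/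
lemma exists_hexMean_near (hq : ∀ i r, 0 ≤ q i r) (hq1 : ∀ i, ∑ r, q i r = 1) {x : ℝ × ℝ} {b : ℝ}
    (hb : ∀ l : ℝ × ℝ, l.1 * x.1 + l.2 * x.2 - hexLambda a q l.1 l.2 ≤ b) {δ : ℝ} (hδ : 0 < δ) :
    ∃ l : ℝ × ℝ, |x.1 - hexMean a q l Prod.fst| < δ ∧ |x.2 - hexMean a q l Prod.snd| < δ ∧
      l.1 * hexMean a q l Prod.fst + l.2 * hexMean a q l Prod.snd - hexLambda a q l.1 l.2 ≤ b := by
  have hb0 : 0 ≤ b := by simpa [hexLambda_zero hq hq1] using hb (0, 0)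
  -- Chosen so that `2 ε b < δ ^ 2`; the `+ 1` keeps the denominator positive when `b = 0`.
  set ε : ℝ := δ ^ 2 / (2 * (b + 1)) with hε
  have hεpos : 0 < ε := by positivity
  have hεb : 2 * ε * b < δ ^ 2 := by
    have : 2 * ε * (b + 1) = δ ^ 2 := by rw [hε]; field_simp
    nlinarith
  set F : ℝ × ℝ → ℝ := fun l => hexLambda a q l.1 l.2 + ε / 2 * (l.1 ^ 2 + l.2 ^ 2) -
    (l.1 * x.1 + l.2 * x.2) with hF
  have hFc : Continuous F :=
    ((continuous_hexLambda hq hq1).add (by fun_prop)).sub (by fun_prop)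
  -- By `hb`, `F l` is at least `ε / 2 * |l|² - b`, so `F` is coercive and has a minimiser.
  have hFt : Tendsto F (cocompact (ℝ × ℝ)) atTop := by
    have h1 : Tendsto (fun l : ℝ × ℝ => ε / 2 * ‖l‖ ^ 2 - b) (cocompact (ℝ × ℝ)) atTop := by
      refine tendsto_atTop_add_const_right _ (-b) ?_
      exact ((tendsto_pow_atTop two_ne_zero).comp
        (tendsto_norm_cocompact_atTop (E := ℝ × ℝ))).const_mul_atTop (by positivity)
    refine tendsto_atTop_mono (fun l => ?_) h1
    have hn : ‖l‖ ^ 2 ≤ l.1 ^ 2 + l.2 ^ 2 := by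
      rw [Prod.norm_def]
      rcases max_choice ‖l.1‖ ‖l.2‖ with h | h <;> rw [h, Real.norm_eq_abs, sq_abs] <;>
        nlinarith [sq_nonneg l.1, sq_nonneg l.2]
    have := hb l
    simp only [hF]
    nlinarith
  obtain ⟨l, hl⟩ := hFc.exists_forall_le hFt
  -- First-order condition at the minimiser: `∇Λ(l) = x - ε l`.
  have hder : ∀ v : ℝ × ℝ, (hexMean a q l fun z => v.1 * z.1 + v.2 * z.2) +
      ε * (l.1 * v.1 + l.2 * v.2) - (v.1 * x.1 + v.2 * x.2) = 0 := by
    intro v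
    have hd : HasDerivAt (fun t : ℝ => F (l + t • v))
        ((hexMean a q l fun z => v.1 * z.1 + v.2 * z.2) + ε * (l.1 * v.1 + l.2 * v.2) -
          (v.1 * x.1 + v.2 * x.2)) 0 := by
      have h1 : HasDerivAt (fun t : ℝ => l.1 + t * v.1) v.1 0 := by
        simpa using ((hasDerivAt_id (0 : ℝ)).mul_const v.1).const_add l.1
      have h2 : HasDerivAt (fun t : ℝ => l.2 + t * v.2) v.2 0 := by
        simpa using ((hasDerivAt_id (0 : ℝ)).mul_const v.2).const_add l.2
      have h3 := (((hasDerivAt_hexLambda (a := a) hq hq1 l v).add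
        (((h1.pow 2).add (h2.pow 2)).const_mul (ε / 2))).sub
          ((h1.mul_const x.1).add (h2.mul_const x.2)))
      refine HasDerivAt.congr_deriv (f := fun t : ℝ => F (l + t • v)) h3 ?_
      push_cast
      ring
    refine IsLocalMin.hasDerivAt_eq_zero (Eventually.of_forall fun t => ?_) hd
    simpa using hl (l + t • v)
  have e1 := hder (1, 0)
  have e2 := hder (0, 1)
  simp only [one_mul, zero_mul, add_zero, zero_add, mul_one, mul_zero] at e1 e2
  change hexMean a q l Prod.fst + _ - _ = 0 at e1
  change hexMean a q l Prod.snd + _ - _ = 0 at e2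
  have h0 : F l ≤ 0 := by simpa [hF, hexLambda_zero hq hq1] using hl 0
  have hbl := hb l
  simp only [hF] at h0
  -- Comparing with `F 0 = 0` gives `ε / 2 * |l|² ≤ l · x - Λ(l) ≤ b`.
  have hsq : ε * (l.1 ^ 2 + l.2 ^ 2) ≤ 2 * b := by linarith
  have hsq' : (ε * l.1) ^ 2 + (ε * l.2) ^ 2 < δ ^ 2 := by nlinarith
  refine ⟨l, ?_, ?_, ?_⟩
  · rw [show x.1 - hexMean a q l Prod.fst = ε * l.1 by linarith]
    exact abs_lt_of_sq_lt_sq (by nlinarith [sq_nonneg (ε * l.2)]) hδ.le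
  · rw [show x.2 - hexMean a q l Prod.snd = ε * l.2 by linarith]
    exact abs_lt_of_sq_lt_sq (by nlinarith [sq_nonneg (ε * l.1)]) hδ.le
  · rw [show hexMean a q l Prod.fst = x.1 - ε * l.1 by linarith,
      show hexMean a q l Prod.snd = x.2 - ε * l.2 by linarith]
    nlinarith [mul_nonneg hεpos.le (sq_nonneg l.1), mul_nonneg hεpos.le (sq_nonneg l.2)]

end

/-! ### Exponential growth rates in the extended reals. -/

section GrowthRate

variable {p : ℕ → ℝ≥0∞} {K b : ℝ}

lemma tendsto_div_nat_add (K b : ℝ) :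
    Tendsto (fun n : ℕ => ((1 / (n : ℝ) : ℝ) : EReal) *
      ENNReal.log (ENNReal.ofReal (Real.exp (K + n * b)))) atTop (𝓝 (b : EReal)) := by
  have h : Tendsto (fun n : ℕ => K / (n : ℝ) + b) atTop (𝓝 b) := by
    simpa using (tendsto_const_div_atTop_nhds_zero_nat K).add_const b
  refine (continuous_coe_real_ereal.continuousAt.tendsto.comp h).congr' ?_
  filter_upwards [eventually_gt_atTop 0] with n hn
  have hn : (n : ℝ) ≠ 0 := by positivity
  rw [ENNReal.log_ofReal_of_pos (Real.exp_pos _), Real.log_exp, ← EReal.coe_mul,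
    Function.comp_apply]
  congr 1
  field_simp

lemma mul_log_le_mul_log {x y : ℝ≥0∞} (n : ℕ) (h : x ≤ y) :
    ((1 / (n : ℝ) : ℝ) : EReal) * ENNReal.log x ≤ ((1 / (n : ℝ) : ℝ) : EReal) * ENNReal.log y :=
  mul_le_mul_of_nonneg_left (ENNReal.log_monotone h) (by exact_mod_cast (by positivity))

lemma le_liminf_of_exp_le (h : ∀ᶠ n : ℕ in atTop, ENNReal.ofReal (Real.exp (K + n * b)) ≤ p n) :
    (b : EReal) ≤
      liminf (fun n : ℕ => ((1 / (n : ℝ) : ℝ) : EReal) * ENNReal.log (p n)) atTop := by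
  rw [← (tendsto_div_nat_add K b).liminf_eq]
  exact liminf_le_liminf (h.mono fun n hn => mul_log_le_mul_log n hn)

lemma limsup_le_of_le_exp (h : ∀ᶠ n : ℕ in atTop, p n ≤ ENNReal.ofReal (Real.exp (K + n * b))) :
    limsup (fun n : ℕ => ((1 / (n : ℝ) : ℝ) : EReal) * ENNReal.log (p n)) atTop ≤
      (b : EReal) := by
  rw [← (tendsto_div_nat_add K b).limsup_eq]
  exact limsup_le_limsup (h.mono fun n hn => mul_log_le_mul_log n hn)

end GrowthRate

/-! ### Goodness of the rate function, and the tilted lower bound. -/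

section

variable {a : ℝ} {q : Fin 2 → Fin 3 → ℝ}

lemma lt_legendre_iff {L : ℝ → ℝ → ℝ} {z : ℝ × ℝ} {b : ℝ} :
    (b : EReal) < legendre L z ↔ ∃ l : ℝ × ℝ, b < l.1 * z.1 + l.2 * z.2 - L l.1 l.2 := by
  simp only [legendre, lt_iSup_iff, EReal.coe_lt_coe_iff]

lemma lowerSemicontinuous_legendre (L : ℝ → ℝ → ℝ) : LowerSemicontinuous (legendre L) := by
  refine lowerSemicontinuous_iSup fun l => Continuous.lowerSemicontinuous ?_
  exact continuous_coe_real_ereal.comp (by fun_prop)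

lemma isGoodRateFunction_legendre_hexLambda (ha : 0 < a) (hq : ∀ i r, 0 ≤ q i r)
    (hq1 : ∀ i, ∑ r, q i r = 1) : IsGoodRateFunction (legendre (hexLambda a q)) where
  nonneg z := by
    refine le_iSup_of_le (0, 0) ?_
    simp [hexLambda_zero hq hq1]
  lowerSemicontinuous := lowerSemicontinuous_legendre _
  isCompact_level η hη := by
    refine Metric.isCompact_of_isClosed_isBounded
      ((lowerSemicontinuous_legendre _).isClosed_preimage _) ?_
    refine (Metric.isBounded_closedBall (x := (0 : ℝ × ℝ)) (r := a + η)).subset fun z hz => ?_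
    have hz : ∀ l : ℝ × ℝ, l.1 * z.1 + l.2 * z.2 - hexLambda a q l.1 l.2 ≤ η := fun l => by
      by_contra! hcon
      exact (lt_legendre_iff.2 ⟨l, hcon⟩).not_ge hz
    have hL := hexLambda_le ha hq hq1
    rw [mem_closedBall_zero_iff, norm_prod_le_iff, Real.norm_eq_abs, Real.norm_eq_abs, abs_le,
      abs_le]
    -- Testing with the four unit vectors `± e₁`, `± e₂`, where Λ is at most `a`, bounds each
    -- coordinate by `a + η`.
    have h1 := hz (1, 0)
    have h2 := hz (-1, 0)
    have h3 := hz (0, 1)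
    have h4 := hz (0, -1)
    have g1 := hL (1, 0)
    have g2 := hL (-1, 0)
    have g3 := hL (0, 1)
    have g4 := hL (0, -1)
    simp only [abs_one, abs_zero, abs_neg] at *
    exact ⟨⟨by linarith, by linarith⟩, by linarith, by linarith⟩

/-- Under the tilted law the walk stays within `O(√n)` of `n` times the mean. -/
lemma exists_walkExp_sq_sub_le (hq : ∀ i r, 0 ≤ q i r) (hq1 : ∀ i, ∑ r, q i r = 1) (l : ℝ × ℝ)
    (φ : ℝ × ℝ →+ ℝ) :
    ∃ C : ℝ, ∀ n : ℕ,
      walkExp (fun k => hexTilt a q l (Fin.ofNat 2 k)) (fun k => hexStep a (Fin.ofNat 2 k)) n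
        (fun z => (φ z - n * hexMean a q l φ) ^ 2) ≤ C * (n + 1) := by
  have hw := hexTilt_nonneg (a := a) hq hq1 l
  have hw1 := sum_hexTilt (a := a) hq hq1 l
  set w := hexTilt a q l
  set m : Fin 2 → ℝ := fun i => ∑ r, w i r * φ (hexStep a i r) with hm
  set v : Fin 2 → ℝ := fun i => ∑ r, w i r * (φ (hexStep a i r) - m i) ^ 2 with hv
  have hv0 : ∀ i, 0 ≤ v i := fun i =>
    Finset.sum_nonneg fun r _ => mul_nonneg (hw i r) (sq_nonneg _)
  set d : ℝ := |(m 0 - m 1) / 2|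
  -- From `(u + v)² ≤ 2u² + 2v²`: a variance of at most `n (v 0 + v 1)`, and a squared centring
  -- error of at most `d ^ 2`.
  refine ⟨2 * (v 0 + v 1) + 2 * d ^ 2, fun n => ?_⟩
  have hvar := walkExp_sq_sub (w := fun k => w (Fin.ofNat 2 k))
    (s := fun k => hexStep a (Fin.ofNat 2 k)) (fun k => hw1 _) φ n
  change walkExp _ _ n (fun z => (φ z - ∑ k ∈ Finset.range n, m (Fin.ofNat 2 k)) ^ 2) =
    ∑ k ∈ Finset.range n, v (Fin.ofNat 2 k) at hvar
  have hc := abs_sum_range_fin_two_sub_le m n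
  set c := ∑ k ∈ Finset.range n, m (Fin.ofNat 2 k)
  have hmean : hexMean a q l φ = (m 0 + m 1) / 2 := rfl
  have hvn : ∑ k ∈ Finset.range n, v (Fin.ofNat 2 k) ≤ n * (v 0 + v 1) := by
    calc ∑ k ∈ Finset.range n, v (Fin.ofNat 2 k) ≤ ∑ k ∈ Finset.range n, (v 0 + v 1) := by
          refine Finset.sum_le_sum fun k _ => ?_
          generalize Fin.ofNat 2 k = j
          have h0 := hv0 0
          have h1 := hv0 1
          fin_cases j
          · exact le_add_of_nonneg_right h1
          · exact le_add_of_nonneg_left h0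
      _ = _ := by simp [mul_add]
  have hcd : (c - n * ((m 0 + m 1) / 2)) ^ 2 ≤ d ^ 2 := by
    rw [← sq_abs]
    exact pow_le_pow_left₀ (abs_nonneg _) hc 2
  calc walkExp (fun k => w (Fin.ofNat 2 k)) (fun k => hexStep a (Fin.ofNat 2 k)) n
        (fun z => (φ z - n * hexMean a q l φ) ^ 2)
      ≤ walkExp (fun k => w (Fin.ofNat 2 k)) (fun k => hexStep a (Fin.ofNat 2 k)) n
        ((2 : ℝ) • (fun z => (φ z - c) ^ 2) + fun _ => 2 * d ^ 2) := by
        refine walkExp_mono (fun k r => hw _ r) n fun z => ?_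
        simp only [Pi.add_apply, Pi.smul_apply, smul_eq_mul]
        rw [hmean]
        nlinarith [sq_nonneg ((φ z - c) - (c - n * ((m 0 + m 1) / 2)))]
    _ = 2 * ∑ k ∈ Finset.range n, v (Fin.ofNat 2 k) + 2 * d ^ 2 := by
        rw [map_add, map_smul, hvar, walkExp_const (fun k => hw1 _), smul_eq_mul]
    _ ≤ _ := by
        have := hv0 0
        have := hv0 1
        have : 0 ≤ (n : ℝ) * d ^ 2 := by positivity
        nlinarith

/-- The factor `1 / 4` leaves total failure probability at most `1 / 2` once both coordinates are
counted. -/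
lemma eventually_mul_add_one_le {C η : ℝ} (hη : 0 < η) :
    ∀ᶠ n : ℕ in atTop, C * ((n : ℝ) + 1) ≤ 1 / 4 * (n * η) ^ 2 := by
  filter_upwards [eventually_ge_atTop (max 1 ⌈8 * |C| / η ^ 2⌉₊)] with n hn
  have h1 : (1 : ℝ) ≤ n := by exact_mod_cast (le_max_left _ _).trans hn
  have h2 : 8 * |C| / η ^ 2 ≤ n :=
    (Nat.le_ceil _).trans (by exact_mod_cast (le_max_right _ _).trans hn)
  rw [div_le_iff₀ (by positivity)] at h2
  have h3 : C * ((n : ℝ) + 1) ≤ |C| * (2 * n) :=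
    mul_le_mul (le_abs_self C) (by linarith) (by linarith) (abs_nonneg C)
  nlinarith

lemma eventually_half_le_walkExp_tilt (hq : ∀ i r, 0 ≤ q i r) (hq1 : ∀ i, ∑ r, q i r = 1)
    (l : ℝ × ℝ) {η : ℝ} (hη : 0 < η) :
    ∀ᶠ n : ℕ in atTop, 1 / 2 ≤
      walkExp (fun k => hexTilt a q l (Fin.ofNat 2 k)) (fun k => hexStep a (Fin.ofNat 2 k)) n
        ({z : ℝ × ℝ | |z.1 - n * hexMean a q l Prod.fst| ≤ n * η ∧
          |z.2 - n * hexMean a q l Prod.snd| ≤ n * η}.indicator 1) := by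
  obtain ⟨C₁, h₁⟩ := exists_walkExp_sq_sub_le (a := a) hq hq1 l (AddMonoidHom.fst ℝ ℝ)
  obtain ⟨C₂, h₂⟩ := exists_walkExp_sq_sub_le (a := a) hq hq1 l (AddMonoidHom.snd ℝ ℝ)
  filter_upwards [eventually_gt_atTop 0, eventually_mul_add_one_le (C := C₁) hη,
    eventually_mul_add_one_le (C := C₂) hη] with n hn e₁ e₂
  have hn : (0 : ℝ) < n := by exact_mod_cast hn
  have h₁ := (h₁ n).trans e₁
  have h₂ := (h₂ n).trans e₂
  simp only [AddMonoidHom.coe_fst, AddMonoidHom.coe_snd] at h₁ h₂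
  set g₁ := hexMean a q l Prod.fst
  set g₂ := hexMean a q l Prod.snd
  set w : ℕ → Fin 3 → ℝ := fun k => hexTilt a q l (Fin.ofNat 2 k)
  set s : ℕ → Fin 3 → ℝ × ℝ := fun k => hexStep a (Fin.ofNat 2 k)
  have hpos : 0 < ((n : ℝ) * η) ^ 2 := by positivity
  -- Chebyshev's inequality in pointwise form: outside the box one of the two squares exceeds `(n
  -- η)²`.
  have hmono : walkExp w s n ((fun _ => (1 : ℝ)) -
      (((n : ℝ) * η) ^ 2)⁻¹ • ((fun z : ℝ × ℝ => (z.1 - n * g₁) ^ 2) +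
        fun z : ℝ × ℝ => (z.2 - n * g₂) ^ 2)) ≤
      walkExp w s n ({z : ℝ × ℝ | |z.1 - n * g₁| ≤ n * η ∧
          |z.2 - n * g₂| ≤ n * η}.indicator 1) := by
    refine walkExp_mono (fun k r => hexTilt_nonneg hq hq1 l _ r) n fun z => ?_
    simp only [Pi.sub_apply, Pi.smul_apply, Pi.add_apply, smul_eq_mul]
    by_cases hz : z ∈ {z : ℝ × ℝ | |z.1 - n * g₁| ≤ n * η ∧ |z.2 - n * g₂| ≤ n * η}
    · rw [Set.indicator_of_mem hz, Pi.one_apply]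
      have : 0 ≤ (((n : ℝ) * η) ^ 2)⁻¹ * ((z.1 - n * g₁) ^ 2 + (z.2 - n * g₂) ^ 2) := by
        positivity
      linarith
    · rw [Set.indicator_of_notMem hz, sub_nonpos, ← div_eq_inv_mul, le_div_iff₀ hpos, one_mul]
      have hz : ¬ (|z.1 - n * g₁| ≤ n * η ∧ |z.2 - n * g₂| ≤ n * η) := hz
      have hnη : 0 ≤ (n : ℝ) * η := by positivity
      rw [not_and_or, not_le, not_le] at hz
      rcases hz with hz | hz
      · have := pow_le_pow_left₀ hnη hz.le 2
        rw [sq_abs] at this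
        nlinarith [sq_nonneg (z.2 - n * g₂)]
      · have := pow_le_pow_left₀ hnη hz.le 2
        rw [sq_abs] at this
        nlinarith [sq_nonneg (z.1 - n * g₁)]
  refine le_trans ?_ hmono
  rw [map_sub, map_smul, map_add, walkExp_const (fun k => sum_hexTilt hq hq1 l _), smul_eq_mul,
    ← div_eq_inv_mul]
  have : (walkExp w s n (fun z : ℝ × ℝ => (z.1 - n * g₁) ^ 2) +
      walkExp w s n (fun z : ℝ × ℝ => (z.2 - n * g₂) ^ 2)) / ((n : ℝ) * η) ^ 2 ≤ 1 / 2 := by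
    rw [div_le_iff₀ hpos]
    linarith
  linarith

/-- The change of measure lower bound for the probability of a neighbourhood of a gradient. -/
lemma exists_exp_le_walkExp (hq : ∀ i r, 0 ≤ q i r) (hq1 : ∀ i, ∑ r, q i r = 1)
    (l : ℝ × ℝ) {η : ℝ} (hη : 0 < η) :
    ∃ K : ℝ, ∀ᶠ n : ℕ in atTop,
      Real.exp (K + n * (hexLambda a q l.1 l.2 - (l.1 * hexMean a q l Prod.fst +
        l.2 * hexMean a q l Prod.snd) - (|l.1| + |l.2|) * η)) ≤
      walkExp (fun k => q (Fin.ofNat 2 k)) (fun k => hexStep a (Fin.ofNat 2 k)) n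
        ({z : ℝ × ℝ | |z.1 - n * hexMean a q l Prod.fst| ≤ n * η ∧
          |z.2 - n * hexMean a q l Prod.snd| ≤ n * η}.indicator 1) := by
  obtain ⟨D, hD⟩ := prod_hexMgf_bounds (a := a) hq hq1 l
  refine ⟨-D + Real.log (1 / 2), ?_⟩
  filter_upwards [eventually_half_le_walkExp_tilt (a := a) hq hq1 l hη] with n hn
  set g₁ := hexMean a q l Prod.fst
  set g₂ := hexMean a q l Prod.snd
  set B : Set (ℝ × ℝ) := {z : ℝ × ℝ | |z.1 - n * g₁| ≤ n * η ∧ |z.2 - n * g₂| ≤ n * η} with hB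
  -- On the box `B`, `l · z ≤ -c`; hence `exp c` times the character is at most 1 there.
  set c : ℝ := -(n * (l.1 * g₁ + l.2 * g₂) + n * ((|l.1| + |l.2|) * η)) with hc
  have hmono : walkExp (fun k => q (Fin.ofNat 2 k)) (fun k => hexStep a (Fin.ofNat 2 k)) n
      (fun z => planeChar l z * (Real.exp c • B.indicator (1 : ℝ × ℝ → ℝ)) z) ≤
      walkExp (fun k => q (Fin.ofNat 2 k)) (fun k => hexStep a (Fin.ofNat 2 k)) n
        (B.indicator 1) := by
    refine walkExp_mono (fun k r => hq _ r) n fun z => ?_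
    by_cases hz : z ∈ B
    · simp only [Pi.smul_apply, Set.indicator_of_mem hz, Pi.one_apply, smul_eq_mul, mul_one,
        planeChar]
      rw [← Real.exp_add, Real.exp_le_one_iff]
      have k1 := (le_abs_self (l.1 * (z.1 - n * g₁))).trans_eq (abs_mul _ _)
      have k2 := (le_abs_self (l.2 * (z.2 - n * g₂))).trans_eq (abs_mul _ _)
      have k3 := mul_le_mul_of_nonneg_left hz.1 (abs_nonneg l.1)
      have k4 := mul_le_mul_of_nonneg_left hz.2 (abs_nonneg l.2)
      rw [hc]
      linarith
    · simp [Set.indicator_of_notMem hz]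
  refine le_trans ?_ hmono
  rw [walkExp_mul_eq_prod_mul (planeChar_zero l) (planeChar_add l)
    (M := fun k => hexMgf a q (Fin.ofNat 2 k) l) (fun k => (hexMgf_pos hq hq1 _ l).ne'), map_smul,
    smul_eq_mul]
  calc Real.exp (-D + Real.log (1 / 2) + n * (hexLambda a q l.1 l.2 - (l.1 * g₁ + l.2 * g₂) -
        (|l.1| + |l.2|) * η))
      = Real.exp (n * hexLambda a q l.1 l.2 - D) * (Real.exp c * (1 / 2)) := by
        rw [show (1 / 2 : ℝ) = Real.exp (Real.log (1 / 2)) from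
          (Real.exp_log (by norm_num)).symm, ← Real.exp_add, ← Real.exp_add, Real.log_exp]
        congr 1
        rw [hc]
        ring
    _ ≤ _ := mul_le_mul (hD n).1 (mul_le_mul_of_nonneg_left hn (Real.exp_pos _).le)
        (by positivity) (Finset.prod_nonneg fun k _ => (hexMgf_pos hq hq1 _ l).le)

end

/-! ### The two large deviation bounds. -/

namespace IsHexWalk

variable {Ω : Type*} [MeasurableSpace Ω] {P : Measure Ω} [IsProbabilityMeasure P] {a : ℝ}
  {q : Fin 2 → Fin 3 → ℝ} {X Y : ℕ → Ω → ℝ}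

lemma ae_abs_le (h : IsHexWalk P a q X Y) (ha : 0 < a) (hq : ∀ i r, 0 ≤ q i r)
    (hq1 : ∀ i, ∑ r, q i r = 1) (n : ℕ) :
    ∀ᵐ ω ∂P, |X n ω| ≤ n * a ∧ |Y n ω| ≤ n * a := by
  induction n with
  | zero =>
    have hm := h.measurable_pair 0 (measurableSet_singleton (0, 0))
    filter_upwards [(mem_ae_iff_prob_eq_one hm).2 h.initial] with ω hω
    have hω : (X 0 ω, Y 0 ω) = (0, 0) := hω
    rw [Prod.mk.injEq] at hω
    simp [hω.1, hω.2]
  | succ n ih =>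
    filter_upwards [ih, h.ae_exists_step ha hq hq1 (h.ae_mem_hexVertices ha hq hq1 n)]
      with ω h1 h2
    obtain ⟨r, hr⟩ := h2
    have hx : X (n + 1) ω = X n ω + (hexStep a (Fin.ofNat 2 n) r).1 := congrArg Prod.fst hr
    have hy : Y (n + 1) ω = Y n ω + (hexStep a (Fin.ofNat 2 n) r).2 := congrArg Prod.snd hr
    rw [hx, hy, Nat.cast_succ, add_mul, one_mul]
    exact ⟨(abs_add_le _ _).trans (add_le_add h1.1 (abs_fst_hexStep_le ha _ r)),
      (abs_add_le _ _).trans (add_le_add h1.2 (abs_snd_hexStep_le ha _ r))⟩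

lemma ae_div_mem_closedBall (h : IsHexWalk P a q X Y) (ha : 0 < a) (hq : ∀ i r, 0 ≤ q i r)
    (hq1 : ∀ i, ∑ r, q i r = 1) {n : ℕ} (hn : 0 < n) :
    ∀ᵐ ω ∂P, ((X n ω / n, Y n ω / n) : ℝ × ℝ) ∈ Metric.closedBall (0 : ℝ × ℝ) a := by
  have hn : (0 : ℝ) < n := by exact_mod_cast hn
  filter_upwards [h.ae_abs_le ha hq hq1 n] with ω hω
  rw [mem_closedBall_zero_iff, norm_prod_le_iff, Real.norm_eq_abs, Real.norm_eq_abs, abs_div,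
    abs_div, abs_of_pos hn, div_le_iff₀ hn, div_le_iff₀ hn, mul_comm a]
  exact hω

/-- Chernoff bound for a half plane. -/
lemma exists_measureReal_halfPlane_le (h : IsHexWalk P a q X Y) (ha : 0 < a)
    (hq : ∀ i r, 0 ≤ q i r) (hq1 : ∀ i, ∑ r, q i r = 1) (l : ℝ × ℝ) (b : ℝ) :
    ∃ D : ℝ, ∀ n : ℕ, 0 < n →
      P.real {ω | b < l.1 * (X n ω / n) + l.2 * (Y n ω / n) - hexLambda a q l.1 l.2} ≤
        Real.exp D * Real.exp (-(n * b)) := by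
  obtain ⟨D, hD⟩ := prod_hexMgf_bounds (a := a) hq hq1 l
  refine ⟨D, fun n hn => ?_⟩
  have hn : (0 : ℝ) < n := by exact_mod_cast hn
  set B : Set (ℝ × ℝ) := {z | b < l.1 * (z.1 / n) + l.2 * (z.2 / n) - hexLambda a q l.1 l.2}
    with hB
  have hBm : MeasurableSet B := measurableSet_lt (by fun_prop) (by fun_prop)
  set c : ℝ := -(n * (b + hexLambda a q l.1 l.2)) with hc
  have hmono : walkExp (fun k => q (Fin.ofNat 2 k)) (fun k => hexStep a (Fin.ofNat 2 k)) n
      (B.indicator 1) ≤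
      walkExp (fun k => q (Fin.ofNat 2 k)) (fun k => hexStep a (Fin.ofNat 2 k)) n
        (Real.exp c • planeChar l) := by
    refine walkExp_mono (fun k r => hq _ r) n fun z => ?_
    simp only [Pi.smul_apply, smul_eq_mul]
    by_cases hz : z ∈ B
    · rw [Set.indicator_of_mem hz, Pi.one_apply, planeChar, ← Real.exp_add, Real.one_le_exp_iff,
        hc]
      have hz : b < l.1 * (z.1 / n) + l.2 * (z.2 / n) - hexLambda a q l.1 l.2 := hz
      have e : l.1 * z.1 + l.2 * z.2 = n * (l.1 * (z.1 / n) + l.2 * (z.2 / n)) := by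
        field_simp
      rw [e]
      nlinarith
    · rw [Set.indicator_of_notMem hz]
      exact mul_nonneg (Real.exp_pos _).le (planeChar_pos _ _).le
  rw [map_smul, walkExp_exp (planeChar_zero l) (planeChar_add l), smul_eq_mul] at hmono
  calc P.real {ω | b < l.1 * (X n ω / n) + l.2 * (Y n ω / n) - hexLambda a q l.1 l.2}
      = walkExp (fun k => q (Fin.ofNat 2 k)) (fun k => hexStep a (Fin.ofNat 2 k)) n
          (B.indicator 1) := h.measureReal_eq_walkExp ha hq hq1 n hBm
    _ ≤ Real.exp c * Real.exp (n * hexLambda a q l.1 l.2 + D) :=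
        hmono.trans (mul_le_mul_of_nonneg_left (hD n).2 (Real.exp_pos _).le)
    _ = _ := by
        rw [← Real.exp_add, ← Real.exp_add, hc]
        congr 1
        ring

lemma limsup_le (h : IsHexWalk P a q X Y) (ha : 0 < a)
    (hq : ∀ i r, 0 ≤ q i r) (hq1 : ∀ i, ∑ r, q i r = 1) {C : Set (ℝ × ℝ)} (hC : IsClosed C) {b : ℝ}
    (hb : ∀ z ∈ C, (b : EReal) < legendre (hexLambda a q) z) :
    limsup (fun n : ℕ => ((1 / (n : ℝ) : ℝ) : EReal) *
      ENNReal.log (P {ω | ((X n ω / n, Y n ω / n) : ℝ × ℝ) ∈ C})) atTop ≤ ((-b : ℝ) : EReal) := by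
  have hK : IsCompact (C ∩ Metric.closedBall (0 : ℝ × ℝ) a) :=
    (isCompact_closedBall _ _).inter_left hC
  -- Every point of `C` has `Λ* > b`, so some `l` witnesses this, and the same `l` works on an open
  -- half plane.
  obtain ⟨t, ht⟩ := hK.elim_finite_subcover
    (fun l : ℝ × ℝ => {z : ℝ × ℝ | b < l.1 * z.1 + l.2 * z.2 - hexLambda a q l.1 l.2})
    (fun l => isOpen_lt (by fun_prop) (by fun_prop))
    (fun z hz => Set.mem_iUnion.2 (lt_legendre_iff.1 (hb z hz.1)))
  choose D hD using fun l => h.exists_measureReal_halfPlane_le ha hq hq1 l b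
  -- The summand 1 keeps the logarithm meaningful when the cover `t` is empty.
  have hpos : 0 < 1 + ∑ l ∈ t, Real.exp (D l) := by positivity
  refine limsup_le_of_le_exp (K := Real.log (1 + ∑ l ∈ t, Real.exp (D l))) ?_
  filter_upwards [eventually_gt_atTop 0] with n hn
  have hsub : P {ω | ((X n ω / n, Y n ω / n) : ℝ × ℝ) ∈ C} ≤
      P (⋃ l ∈ t, {ω | b < l.1 * (X n ω / n) + l.2 * (Y n ω / n) - hexLambda a q l.1 l.2}) := by
    refine measure_mono_ae ?_
    filter_upwards [h.ae_div_mem_closedBall ha hq hq1 hn] with ω hω hωC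
    have := ht ⟨hωC, hω⟩
    rw [Set.mem_iUnion₂] at this
    exact Set.mem_iUnion₂.2 this
  refine hsub.trans ?_
  rw [← ofReal_measureReal (measure_ne_top _ _)]
  refine ENNReal.ofReal_le_ofReal ((measureReal_biUnion_finset_le _ _).trans ?_)
  calc ∑ l ∈ t, P.real {ω | b < l.1 * (X n ω / n) + l.2 * (Y n ω / n) - hexLambda a q l.1 l.2}
      ≤ ∑ l ∈ t, Real.exp (D l) * Real.exp (-(n * b)) :=
        Finset.sum_le_sum fun l _ => hD l n hn
    _ ≤ (1 + ∑ l ∈ t, Real.exp (D l)) * Real.exp (-(n * b)) := by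
        rw [← Finset.sum_mul]
        exact mul_le_mul_of_nonneg_right (by linarith) (Real.exp_pos _).le
    _ = _ := by rw [Real.exp_add, Real.exp_log hpos, mul_neg]

lemma le_liminf (h : IsHexWalk P a q X Y) (ha : 0 < a)
    (hq : ∀ i r, 0 ≤ q i r) (hq1 : ∀ i, ∑ r, q i r = 1) {O : Set (ℝ × ℝ)} (hO : IsOpen O)
    {x : ℝ × ℝ} (hx : x ∈ O) {b : ℝ} (hb : legendre (hexLambda a q) x < b) :
    ((-b : ℝ) : EReal) ≤ liminf (fun n : ℕ => ((1 / (n : ℝ) : ℝ) : EReal) *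
      ENNReal.log (P {ω | ((X n ω / n, Y n ω / n) : ℝ × ℝ) ∈ O})) atTop := by
  obtain ⟨b', hb', hlt⟩ := EReal.lt_iff_exists_real_btwn.1 hb
  have hlt : b' < b := by exact_mod_cast hlt
  have hle : ∀ l : ℝ × ℝ, l.1 * x.1 + l.2 * x.2 - hexLambda a q l.1 l.2 ≤ b' := fun l => by
    by_contra! hcon
    exact (lt_legendre_iff.2 ⟨l, hcon⟩).not_ge hb'.le
  obtain ⟨δ, hδ, hball⟩ := Metric.isOpen_iff.1 hO x hx
  obtain ⟨l, hl1, hl2, hl⟩ := exists_hexMean_near (a := a) hq hq1 hle (half_pos hδ)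
  set g₁ := hexMean a q l Prod.fst
  set g₂ := hexMean a q l Prod.snd
  -- The box must stay within the remaining `δ / 2` of room in `O`, and the oscillation of the
  -- character over it must fit into the gap `b - b'`.
  obtain ⟨η, hη, hηδ, hηb⟩ : ∃ η : ℝ, 0 < η ∧ η ≤ δ / 2 ∧ (|l.1| + |l.2|) * η ≤ b - b' := by
    refine ⟨min (δ / 2) ((b - b') / (|l.1| + |l.2| + 1)), ?_, min_le_left _ _, ?_⟩
    · have : 0 < b - b' := sub_pos.2 hlt
      positivity
    · have hs : 0 ≤ |l.1| + |l.2| := by positivity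
      calc _ ≤ (|l.1| + |l.2|) * ((b - b') / (|l.1| + |l.2| + 1)) :=
            mul_le_mul_of_nonneg_left (min_le_right _ _) hs
        _ ≤ _ := by
          rw [mul_div_assoc', div_le_iff₀ (by positivity)]
          nlinarith
  obtain ⟨K, hK⟩ := exists_exp_le_walkExp (a := a) hq hq1 l hη
  refine le_liminf_of_exp_le (K := K) ?_
  filter_upwards [hK, eventually_gt_atTop 0] with n hn hn0
  have hn0 : (0 : ℝ) < n := by exact_mod_cast hn0
  have hBm : MeasurableSet {z : ℝ × ℝ | |z.1 - n * g₁| ≤ n * η ∧ |z.2 - n * g₂| ≤ n * η} := by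
    have h1 : IsClosed {z : ℝ × ℝ | |z.1 - n * g₁| ≤ n * η} :=
      isClosed_le (by fun_prop) (by fun_prop)
    have h2 : IsClosed {z : ℝ × ℝ | |z.2 - n * g₂| ≤ n * η} :=
      isClosed_le (by fun_prop) (by fun_prop)
    exact h1.measurableSet.inter h2.measurableSet
  rw [← h.measureReal_eq_walkExp ha hq hq1 n hBm] at hn
  have hsub : {ω | (X n ω, Y n ω) ∈
      {z : ℝ × ℝ | |z.1 - n * g₁| ≤ n * η ∧ |z.2 - n * g₂| ≤ n * η}} ⊆
      {ω | ((X n ω / n, Y n ω / n) : ℝ × ℝ) ∈ O} := by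
    rintro ω ⟨h1, h2⟩
    have key : ∀ u g y : ℝ, |u - n * g| ≤ n * η → |y - g| < δ / 2 → dist (u / n) y < δ := by
      intro u g y hu hy
      have e : u / n - y = (u - n * g) / n - (y - g) := by
        field_simp
        ring
      rw [Real.dist_eq, e]
      refine (abs_sub _ _).trans_lt ?_
      have : |(u - n * g) / n| ≤ η := by
        rw [abs_div, abs_of_pos hn0, div_le_iff₀ hn0, mul_comm η]
        exact hu
      linarith
    exact hball (max_lt (key _ _ _ h1 hl1) (key _ _ _ h2 hl2))
  refine le_trans ?_ (measure_mono hsub)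
  rw [← ofReal_measureReal (measure_ne_top _ _)]
  refine ENNReal.ofReal_le_ofReal (le_trans (Real.exp_le_exp.2 ?_) hn)
  have : (n : ℝ) * -b ≤ n * (hexLambda a q l.1 l.2 - (l.1 * g₁ + l.2 * g₂) -
      (|l.1| + |l.2|) * η) := mul_le_mul_of_nonneg_left (by linarith) hn0.le
  linarith

end IsHexWalk

theorem proposition5 {Ω : Type*} [MeasurableSpace Ω] (P : Measure Ω) [IsProbabilityMeasure P]
    (a : ℝ) (ha : 0 < a) (q : Fin 2 → Fin 3 → ℝ)
    (hq : ∀ i r, 0 ≤ q i r) (hq1 : ∀ i, ∑ r, q i r = 1)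
    (X Y : ℕ → Ω → ℝ) (hXY : IsHexWalk P a q X Y) :
    SatisfiesLDP P (fun n ω => (X n ω / n, Y n ω / n)) (fun n => (n : ℝ))
        (legendre (hexLambda a q)) ∧
      IsGoodRateFunction (legendre (hexLambda a q)) := by
  have hgood := isGoodRateFunction_legendre_hexLambda ha hq hq1
  refine ⟨⟨fun n _ => ?_, fun n hn => by exact_mod_cast hn, tendsto_natCast_atTop_atTop,
    hgood.toIsRateFunction, fun O hO => ?_, fun C hC => ?_⟩, hgood⟩
  · exact ((hXY.measurable_fst n).div_const _).prodMk ((hXY.measurable_snd n).div_const _)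
  -- Both bounds are reduced to real `b` strictly on one side of the rate, which also covers
  -- infinite values of the infimum.
  · rw [EReal.neg_le]
    refine le_iInf₂ fun x hx => EReal.le_of_forall_lt_iff_le.1 fun b hb => ?_
    rw [EReal.neg_le]
    exact hXY.le_liminf ha hq hq1 hO hx hb
  · rw [EReal.le_neg]
    refine EReal.ge_of_forall_gt_iff_ge.1 fun b hb => ?_
    rw [EReal.le_neg]
    exact hXY.limsup_le ha hq hq1 hC fun z hz => hb.trans_le (iInf₂_le z hz)
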